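/- **Setting.** A central node distributes $p=\lambda n$ sub-tasks ($\lambda\ge 1$) to $n$ workers by the balanced cyclic allocation with replication $\rho=s+u<n$, where $1\le u\le s$: for $0\le i<\lambda n$, sub-task $i$ is allotted to the set $N(i)$ of the workers $i,i+1,\dots,i+\rho-1$ modulo $n$. The sub-task results are elements of an arbitrary alphabet. In an attack, at most $s$ workers are malicious and report arbitrary values for their allotted sub-tasks; all other workers report the true values. All reports are sent to the central node, which may also query an oracle for the true result of a sub-task (a *local computation*). Workers it finds to be malicious are *marked* and their responses discarded; the remaining ones are *active*. A sub-task is *corrupted* if two of its active workers disagree; its number of *disagreeing* workers is the number of its active workers outside a largest agreeing set. After a local computation of a sub-task, all its active workers that reported another value are marked. **Full Communication Protocol.** 1. As long as in some sub-task an agreeing set has fewer than $u$ workers, mark them. 2. When no such set is left and some sub-task has more than $u$ disagreeing workers, locally compute one with the largest number of disagreeing workers (ties broken arbitrarily), and return to 1. 3. Otherwise continue with the logic-based subroutine, marking sets as in 1 whenever possible: * If in a corrupted sub-task an agreeing set is larger than $s$ minus the number of marked workers, mark the other active workers of this sub-task. * If this is not possible, go over pairs of corrupted sub-tasks $i\ne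 j$. Let $W_i$ be a set of $u$ agreeing active workers of $i$ such that the set $B_i$ of all other active workers of $i$ agrees on a different value and $|B_i|\ge u$; let $W_j,B_j$ be the same for $j$. - If $W_i=W_j$ and $B_i\ne B_j$, mark $W_i$. - If $W_i\ne W_j$ and $W_i\cap W_j\ne\emptyset$: locally compute $i$ if $B_i=B_j$, and mark $W_i\cup W_j$ if $B_i\neq B_j$. - If $W_i\cap W_j=\emptyset$, $W_j\not\subseteq N(i)$ and $W_i\cap N(j)\ne\emptyset$, mark $W_i$. - If $W_i\cap N(j)=\emptyset=W_j\cap N(i)$: locally compute $i$ if $B_i=B_j$, and mark $W_i\cup W_j$ if $B_i\ne B_j$. * If none of this applies to any pair, locally compute any remaining corrupted sub-task. 4. The protocol stops when nothing of this applies. It outputs for every sub-task its locally computed value, if there is one, and otherwise the value reported by all its active workers. **Theorem.** Put $$k_\lambda^*=\left\lfloor\frac{\rho+1}{u+\frac1\lambda}\right\rfloor .$$ (a) Against every attack, every run of the Full Communication Protocol (for all ways of breaking ties and all orders of going through the sub-tasks and pairs) terminates, outputs the true result of every sub-task, and uses at most $$c\le\min\left\{k_\lambda^*,\left\lfloor\frac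 su\right\rfloor\right\}$$ local computations. (b) This is optimal: if the alphabet has at least two elements, there is an attack against which every protocol (an adaptive choice of local computations and a final estimate, based on all reports and the results of earlier local computations) that recovers all sub-task results against every attack locally computes at least $\min\{k_\lambda^*,\lfloor s/u\rfloor\}$ sub-tasks. -/

import Mathlib

namespace ByzantineComputation

/-- The balanced cyclic job allocation of `lam * n` sub-tasks to `n` workers with replication `rho`
(for `rho ≤ n`): `lam` stacked copies of the cyclic `n × n` zero-one matrix whose row `i` has its
ones in the cyclically consecutive columns `i, i + 1, …, i + rho - 1` modulo `n`.
The matrix is given by its rows: `cyclicAllocation n lam rho i` is the set of workers to which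
sub-task `i` is allotted. -/
def cyclicAllocation (n lam rho : ℕ) (i : Fin (lam * n)) : Finset (Fin n) :=
  Finset.univ.filter fun j => ∃ r ∈ Finset.range rho, (i.val + r) % n = j.val

section Model

variable {p n : ℕ} {α : Type*}

/-- An attack with true results `T`, malicious workers `M` and reported table `R` (where `R i j` is
the report of worker `j` on sub-task `i`, meaningful only if `j` is allotted sub-task `i`): there are
at most `s` malicious workers, their reports are arbitrary, and the others report the truth. -/
def IsAttack (N : Fin p → Finset (Fin n)) (s : ℕ) (T : Fin p → α) (M : Finset (Fin n))
    (R : Fin p → Fin n → α) : Prop :=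
  M.card ≤ s ∧ ∀ i, ∀ j ∈ N i, j ∉ M → R i j = T i

/-! ### The Full Communication Protocol -/

/-- What the central node keeps track of during the protocol: the workers it has marked as malicious
(all their responses are discarded), and the results of the local computations made so far. -/
structure State (p n : ℕ) (α : Type*) where
  marked : Finset (Fin n)
  computed : Fin p → Option α

/-- The initial state. -/
def State.start : State p n α := ⟨∅, fun _ => none⟩

/-- The number of sub-tasks computed locally. -/
def State.cost (st : State p n α) : ℕ :=
  (Finset.univ.filter fun i => (st.computed i).isSome).card

/-- Mark the workers in `X` as malicious. -/
def State.mark (st : State p n α) (X : Finset (Fin n)) : State p n α :=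
  ⟨st.marked ∪ X, st.computed⟩

/-- The workers whose responses to sub-task `i` are still in use. -/
def active (N : Fin p → Finset (Fin n)) (st : State p n α) (i : Fin p) : Finset (Fin n) :=
  N i \ st.marked

variable [DecidableEq α]

/-- The active workers that report the value `v` for sub-task `i`. -/
def group (N : Fin p → Finset (Fin n)) (R : Fin p → Fin n → α) (st : State p n α)
    (i : Fin p) (v : α) : Finset (Fin n) :=
  (active N st i).filter fun j => R i j = v

/-- Sub-task `i` is (visibly) corrupted: two of its active workers disagree. -/
def Corrupted (N : Fin p → Finset (Fin n)) (R : Fin p → Fin n → α) (st : State p n α)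
    (i : Fin p) : Prop :=
  ∃ j ∈ active N st i, ∃ k ∈ active N st i, R i j ≠ R i k

/-- The number of disagreeing workers in sub-task `i`: the active workers outside a largest
agreeing set. -/
def disagreement (N : Fin p → Finset (Fin n)) (R : Fin p → Fin n → α) (st : State p n α)
    (i : Fin p) : ℕ :=
  (active N st i).card - (active N st i).sup fun j => (group N R st i (R i j)).card

/-- A local computation of sub-task `i`: the oracle returns the true result `T i`, and all active
workers that reported something else are marked as malicious. -/
def localCompute (N : Fin p → Finset (Fin n)) (T : Fin p → α) (R : Fin p → Fin n → α)
    (st : State p n α) (i : Fin p) : State p n α :=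
  ⟨st.marked ∪ (active N st i).filter fun j => R i j ≠ T i,
    Function.update st.computed i (some (T i))⟩

/-- If fewer than `u` workers agree on a value for some sub-task, they are marked as malicious. -/
inductive SmallGroupRule (N : Fin p → Finset (Fin n)) (u : ℕ) (R : Fin p → Fin n → α) :
    State p n α → State p n α → Prop
  | mk (st : State p n α) (i : Fin p) (v : α) (hne : (group N R st i v).Nonempty)
      (hlt : (group N R st i v).card < u) :
      SmallGroupRule N u R st (st.mark (group N R st i v))

/-- If, in a corrupted sub-task, more workers agree on a value than there can be malicious workers
left (at most `s` minus the number of marked ones), then the other workers are marked. -/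
inductive LargeGroupRule (N : Fin p → Finset (Fin n)) (s : ℕ) (R : Fin p → Fin n → α) :
    State p n α → State p n α → Prop
  | mk (st : State p n α) (i : Fin p) (v : α) (hc : Corrupted N R st i)
      (hlt : s < st.marked.card + (group N R st i v).card) :
      LargeGroupRule N s R st (st.mark (active N st i \ group N R st i v))

/-- In sub-task `i`, a set `W` of exactly `u` workers agree with each other and disagree with the set
`B` of all remaining active workers, who also agree with each other and are at least as many.
(If `B` has `u` workers as well, then either of the two sets may play the role of `W`.) -/
def Split (N : Fin p → Finset (Fin n)) (u : ℕ) (R : Fin p → Fin n → α) (st : State p n α)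
    (i : Fin p) (W B : Finset (Fin n)) : Prop :=
  ∃ v w : α, v ≠ w ∧ W = group N R st i v ∧ B = group N R st i w ∧
    active N st i = W ∪ B ∧ W.card = u ∧ u ≤ B.card

/-- The first loop of the logic-based protocol: what it does with two corrupted sub-tasks `i`, `j`
with disagreeing sets `Wi`, `Wj` and agreeing sets `Bi`, `Bj`. No rule applies when `Wi = Wj` and
`Bi = Bj`, or when `Wi`, `Wj` are disjoint and `Wi ⊆ N j`, `Wj ⊆ N i`. -/
inductive PairRule (N : Fin p → Finset (Fin n)) (u : ℕ) (T : Fin p → α) (R : Fin p → Fin n → α) :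
    State p n α → State p n α → Prop
  /-- Same disagreeing set, different agreeing sets. -/
  | same (st : State p n α) (i j : Fin p) (Wi Bi Wj Bj : Finset (Fin n)) (hij : i ≠ j)
      (hi : Split N u R st i Wi Bi) (hj : Split N u R st j Wj Bj)
      (hW : Wi = Wj) (hB : Bi ≠ Bj) :
      PairRule N u T R st (st.mark Wi)
  /-- Different but overlapping disagreeing sets, same agreeing set. -/
  | overlapCompute (st : State p n α) (i j : Fin p) (Wi Bi Wj Bj : Finset (Fin n)) (hij : i ≠ j)
      (hi : Split N u R st i Wi Bi) (hj : Split N u R st j Wj Bj)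
      (hW : Wi ≠ Wj) (hWW : ¬ Disjoint Wi Wj) (hB : Bi = Bj) :
      PairRule N u T R st (localCompute N T R st i)
  /-- Different but overlapping disagreeing sets, different agreeing sets. -/
  | overlapMark (st : State p n α) (i j : Fin p) (Wi Bi Wj Bj : Finset (Fin n)) (hij : i ≠ j)
      (hi : Split N u R st i Wi Bi) (hj : Split N u R st j Wj Bj)
      (hW : Wi ≠ Wj) (hWW : ¬ Disjoint Wi Wj) (hB : Bi ≠ Bj) :
      PairRule N u T R st (st.mark (Wi ∪ Wj))
  /-- Disjoint disagreeing sets, `Wj` is not entirely allotted `i`, and some worker of `Wi` is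
  allotted `j`. -/
  | disjointMark (st : State p n α) (i j : Fin p) (Wi Bi Wj Bj : Finset (Fin n)) (hij : i ≠ j)
      (hi : Split N u R st i Wi Bi) (hj : Split N u R st j Wj Bj)
      (hWW : Disjoint Wi Wj) (hWj : ¬ Wj ⊆ N i) (hWi : ¬ Disjoint Wi (N j)) :
      PairRule N u T R st (st.mark Wi)
  /-- No worker of either disagreeing set is allotted the other sub-task, same agreeing set. -/
  | apartCompute (st : State p n α) (i j : Fin p) (Wi Bi Wj Bj : Finset (Fin n)) (hij : i ≠ j)
      (hi : Split N u R st i Wi Bi) (hj : Split N u R st j Wj Bj)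
      (hWi : Disjoint Wi (N j)) (hWj : Disjoint Wj (N i)) (hB : Bi = Bj) :
      PairRule N u T R st (localCompute N T R st i)
  /-- No worker of either disagreeing set is allotted the other sub-task, different agreeing
  sets. -/
  | apartMark (st : State p n α) (i j : Fin p) (Wi Bi Wj Bj : Finset (Fin n)) (hij : i ≠ j)
      (hi : Split N u R st i Wi Bi) (hj : Split N u R st j Wj Bj)
      (hWi : Disjoint Wi (N j)) (hWj : Disjoint Wj (N i)) (hB : Bi ≠ Bj) :
      PairRule N u T R st (st.mark (Wi ∪ Wj))

/-- The greedy phase is over: no agreeing set has fewer than `u` workers, and every corrupted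
sub-task has at most `u` disagreeing workers. (Marking workers never increases a disagreement, so
from here on there is no way back to greedy local computations.) -/
def LogicStage (N : Fin p → Finset (Fin n)) (u : ℕ) (R : Fin p → Fin n → α)
    (st : State p n α) : Prop :=
  (∀ st', ¬ SmallGroupRule N u R st st') ∧ ∀ i, Corrupted N R st i → disagreement N R st i ≤ u

/-- One step of the Full Communication Protocol, for at most `s` malicious workers and replication
`s + u`. The relation is nondeterministic: it allows all ways of breaking ties and all orders of
going through the sub-tasks and the pairs of sub-tasks. The true results `T` enter only through
local computations. -/
inductive Step (N : Fin p → Finset (Fin n)) (s u : ℕ) (T : Fin p → α) (R : Fin p → Fin n → α) :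
    State p n α → State p n α → Prop
  /-- Mark the members of agreeing sets with fewer than `u` workers. -/
  | small (st st' : State p n α) (h : SmallGroupRule N u R st st') : Step N s u T R st st'
  /-- When this is done, greedily compute a sub-task with the largest number of disagreeing
  workers, as long as this number exceeds `u`. -/
  | greedy (st : State p n α) (i : Fin p) (hsmall : ∀ st', ¬ SmallGroupRule N u R st st')
      (hmax : ∀ k, disagreement N R st k ≤ disagreement N R st i)
      (hu : u < disagreement N R st i) : Step N s u T R st (localCompute N T R st i)
  /-- Logic-based protocol: resolve sub-tasks with an agreeing set that is too large to be
  malicious. -/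
  | large (st st' : State p n α) (hst : LogicStage N u R st) (h : LargeGroupRule N s R st st') :
      Step N s u T R st st'
  /-- Logic-based protocol, first loop. -/
  | pair (st st' : State p n α) (hst : LogicStage N u R st)
      (hlarge : ∀ st'', ¬ LargeGroupRule N s R st st'') (h : PairRule N u T R st st') :
      Step N s u T R st st'
  /-- Logic-based protocol, second loop: compute a remaining corrupted sub-task. -/
  | last (st : State p n α) (i : Fin p) (hst : LogicStage N u R st)
      (hlarge : ∀ st', ¬ LargeGroupRule N s R st st') (hpair : ∀ st', ¬ PairRule N u T R st st')
      (hi : Corrupted N R st i) : Step N s u T R st (localCompute N T R st i)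

/-- In state `st` the central node outputs `v` for sub-task `i`: either `v` was computed locally, or
there are active workers for `i` and all of them report `v`. -/
def Outputs (N : Fin p → Finset (Fin n)) (R : Fin p → Fin n → α) (st : State p n α)
    (i : Fin p) (v : α) : Prop :=
  st.computed i = some v ∨
    st.computed i = none ∧ (active N st i).Nonempty ∧ ∀ j ∈ active N st i, R i j = v

end Model

/-! ### Arbitrary protocols (for the lower bound) -/

/-- What a central node may do once it has received responses: query the oracle adaptively for the
true results of sub-tasks, and finally output an estimate of all results. -/
inductive Strategy (p : ℕ) (α : Type*) where
  | output (est : Fin p → α) : Strategy p α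
  | query (i : Fin p) (next : α → Strategy p α) : Strategy p α

namespace Strategy

variable {p : ℕ} {α : Type*}

/-- The final estimate when the true results are `T`. -/
def result (T : Fin p → α) : Strategy p α → Fin p → α
  | output est => est
  | query i next => result T (next (T i))

/-- The set of locally computed sub-tasks when the true results are `T`. -/
def queried (T : Fin p → α) : Strategy p α → Finset (Fin p)
  | output _ => ∅
  | query i next => insert i (queried T (next (T i)))

end Strategy

/-- The responses that the central node can obtain: those of all workers to all their allotted
sub-tasks. -/
def view {p n : ℕ} {α : Type*} (N : Fin p → Finset (Fin n)) (R : Fin p → Fin n → α) :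
    Fin p → Fin n → Option α :=
  fun i j => if j ∈ N i then some (R i j) else none

/-- A (full-information) protocol, that is, a choice of strategy depending on all responses, is
correct if it recovers the results of all sub-tasks against every attack. -/
def IsCorrect {p n : ℕ} {α : Type*} (N : Fin p → Finset (Fin n)) (s : ℕ)
    (P : (Fin p → Fin n → Option α) → Strategy p α) : Prop :=
  ∀ (T : Fin p → α) (M : Finset (Fin n)) (R : Fin p → Fin n → α), IsAttack N s T M R →
    (P (view N R)).result T = T

/-- The bound `min {⌊(ρ + 1) / (u + 1 / λ)⌋, ⌊s / u⌋}` with `ρ = s + u`. -/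
def computationBound (s u lam : ℕ) : ℕ :=
  min ⌊((s : ℚ) + u + 1) / (u + 1 / (lam : ℚ))⌋₊ ⌊(s : ℚ) / u⌋₊

end ByzantineComputation

namespace ByzantineComputation

/-! Correctness rests on the invariant `Sound`: only malicious workers are ever marked. Each
sub-task has at least `u` honest workers, so a smaller agreeing set is lying. If a sub-task splits
into `W` of size `u` and `B`, then either `W` is malicious or `B` is exactly the set of unmarked
malicious workers (`Split.dichotomy`); this justifies the pair rules. Every step marks somebody new,
so runs are finite, and a final state has no corrupted sub-task.

A local computation marks at least `u` workers, whence `c * u ≤ s`. For the other bound, every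
computation before the second loop is charged `u + 1` marked workers: a greedy one marks that many
at once, and one made by a pair rule marks at least `u` and leaves a state from which the next step
can only be a marking (`PairRule.idle`).

Let `st₀` be the state at the first computation of the second loop, `m` its number of marked workers
and `D` the set of sub-tasks computed from then on. As no earlier rule applies in `st₀`, the sets
`W` of the members of `D` are disjoint, and together with the marked workers they form a set `X` of
`m + |D| * u` workers allotted to every member of `D` (`SecondLoop.exists_common`). The cyclic
allocation forces `|D| + lam * |X| ≤ lam * (rho + 1)` (`card_add_mul_card_le`). Adding the charges
for the earlier computations gives `c * (lam * u + 1) ≤ lam * (rho + 1)`.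

The lower bound realizes this configuration: `K` sub-tasks share `K * u` workers, and in each a
block of `u` of them, disjoint from the other blocks, dissents. Either side may be truthful, so each
of these sub-tasks must be computed (`exists_hard_attack`). -/

/-! ### Intersections of worker sets in the cyclic allocation -/

theorem mem_cyclicAllocation {n lam rho : ℕ} {i : Fin (lam * n)} {j : Fin n} :
    j ∈ cyclicAllocation n lam rho i ↔ ∃ r < rho, (i.val + r) % n = j.val := by
  simp [cyclicAllocation]

theorem card_cyclicAllocation {n lam rho : ℕ} (h : rho < n) (i : Fin (lam * n)) :
    (cyclicAllocation n lam rho i).card = rho := by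
  have hn : 0 < n := by omega
  have : cyclicAllocation n lam rho i =
      (Finset.range rho).image fun r => (⟨(i.val + r) % n, Nat.mod_lt _ hn⟩ : Fin n) := by
    ext j
    simp [mem_cyclicAllocation, Fin.ext_iff]
  rw [this, Finset.card_image_of_injOn, Finset.card_range]
  intro r hr r' hr' he
  simp only [Finset.coe_range, Set.mem_Iio, Fin.mk.injEq] at hr hr' he
  have : r ≡ r' [MOD n] := Nat.ModEq.add_left_cancel' i.val he
  exact Nat.ModEq.eq_of_lt_of_lt this (by omega) (by omega)

/-- The workers at cyclic distance `rho, …, rho + k - 1` from some sub-task in `D`. -/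
def cyclicCover {n lam : ℕ} (D : Finset (Fin (lam * n))) (rho k : ℕ) : Finset (Fin n) :=
  Finset.univ.filter fun j => ∃ i ∈ D, ∃ r < k, (i.val + rho + r) % n = j.val

theorem mem_cyclicCover {n lam rho k : ℕ} {D : Finset (Fin (lam * n))} {j : Fin n} :
    j ∈ cyclicCover D rho k ↔ ∃ i ∈ D, ∃ r < k, (i.val + rho + r) % n = j.val := by
  simp [cyclicCover]

theorem eq_univ_of_cyclic_succ_mem {n : ℕ} {F : Finset (Fin n)} (hne : F.Nonempty)
    (h : ∀ j k : Fin n, j ∈ F → (j.val + 1) % n = k.val → k ∈ F) : F = Finset.univ := by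
  obtain ⟨y, hy⟩ := hne
  have hn : 0 < n := y.pos
  have key : ∀ t : ℕ, (⟨(y.val + t) % n, Nat.mod_lt _ hn⟩ : Fin n) ∈ F := by
    intro t
    induction t with
    | zero => simpa [Nat.mod_eq_of_lt y.isLt] using hy
    | succ t ih => exact h _ _ ih (by simp [add_assoc])
  refine Finset.eq_univ_iff_forall.2 fun z => ?_
  have hz := key (z.val + (n - y.val))
  have he : (y.val + (z.val + (n - y.val))) % n = z.val := by
    have : y.val + (z.val + (n - y.val)) = z.val + n := by omega
    rw [this, Nat.add_mod_right, Nat.mod_eq_of_lt z.isLt]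
  convert hz using 1
  exact Fin.ext he.symm

/-- If widening the window by one added no worker, the cover would be closed under the cyclic
successor and hence contain everybody. -/
theorem card_cyclicCover_succ {n lam rho k : ℕ} {D : Finset (Fin (lam * n))} (hD : D.Nonempty)
    (hk : 1 ≤ k) (h : cyclicCover D rho (k + 1) ≠ Finset.univ) :
    (cyclicCover D rho k).card + 1 ≤ (cyclicCover D rho (k + 1)).card := by
  have hsub : cyclicCover D rho k ⊆ cyclicCover D rho (k + 1) := by
    intro j hj
    obtain ⟨i, hi, r, hr, he⟩ := mem_cyclicCover.1 hj
    exact mem_cyclicCover.2 ⟨i, hi, r, by omega, he⟩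
  refine Finset.card_lt_card (hsub.ssubset_of_ne fun heq => h ?_)
  obtain ⟨i, hi⟩ := hD
  have hn : 0 < n := Nat.pos_of_ne_zero fun h0 => by
    have := i.isLt
    simp [h0] at this
  refine eq_univ_of_cyclic_succ_mem
    ⟨⟨(i.val + rho + 0) % n, Nat.mod_lt _ hn⟩, mem_cyclicCover.2 ⟨i, hi, 0, by omega, rfl⟩⟩ ?_
  intro j l hj hl
  rw [← heq] at hj
  obtain ⟨i', hi', r, hr, he⟩ := mem_cyclicCover.1 hj
  refine mem_cyclicCover.2 ⟨i', hi', r + 1, by omega, ?_⟩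
  rw [← hl, ← he]
  simp [add_assoc]

theorem card_cyclicCover {n lam rho k : ℕ} {D : Finset (Fin (lam * n))} (hD : D.Nonempty)
    (h : cyclicCover D rho (k + 1) ≠ Finset.univ) :
    (cyclicCover D rho 1).card + k ≤ (cyclicCover D rho (k + 1)).card := by
  induction k with
  | zero => simp
  | succ k ih =>
    have h' : cyclicCover D rho (k + 1) ≠ Finset.univ := fun he => h <|
      Finset.eq_univ_iff_forall.2 fun j => by
        obtain ⟨i, hi, r, hr, e⟩ := mem_cyclicCover.1 (he ▸ Finset.mem_univ j)
        exact mem_cyclicCover.2 ⟨i, hi, r, by omega, e⟩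
    have := card_cyclicCover_succ hD (by omega) h
    have := ih h'
    omega

/-- Sub-tasks sending the window of length one to the same worker agree modulo `n`, so there is at
most one of them in each of the `lam` copies. -/
theorem card_le_mul_card_cyclicCover {n lam : ℕ} (D : Finset (Fin (lam * n))) (rho : ℕ) :
    D.card ≤ lam * (cyclicCover D rho 1).card := by
  rcases D.eq_empty_or_nonempty with rfl | ⟨i₀, hi₀⟩
  · simp
  have hn : 0 < n := Nat.pos_of_ne_zero fun h0 => by
    have := i₀.isLt
    simp [h0] at this
  refine Finset.card_le_mul_card_image_of_maps_to
    (f := fun i : Fin (lam * n) => (⟨(i.val + rho) % n, Nat.mod_lt _ hn⟩ : Fin n))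
    (fun i hi => mem_cyclicCover.2 ⟨i, hi, 0, by omega, rfl⟩) lam fun c _ => ?_
  refine (Finset.card_le_card_of_injOn (t := Finset.range lam) (fun i => i.val / n)
    (fun i _ => ?_) ?_).trans_eq (Finset.card_range lam)
  · simp only [Finset.coe_range, Set.mem_Iio]
    exact Nat.div_lt_of_lt_mul (i.isLt.trans_eq (mul_comm _ _))
  · intro i hi i' hi' he
    simp only [Finset.coe_filter, Set.mem_ofPred_eq, Fin.ext_iff] at hi hi'
    have hm : i.val ≡ i'.val [MOD n] :=
      Nat.ModEq.add_right_cancel' rho (hi.2.trans hi'.2.symm)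
    apply Fin.ext
    rw [← Nat.div_add_mod i.val n, ← Nat.div_add_mod i'.val n]
    simp only at he
    rw [he, show i.val % n = i'.val % n from hm]

/-- The sets of workers of many sub-tasks have a small intersection. -/
theorem card_add_mul_card_le {n lam rho : ℕ} (hrho : rho < n) {D : Finset (Fin (lam * n))}
    (hD : D.Nonempty) {X : Finset (Fin n)} (hX : X.Nonempty)
    (h : ∀ i ∈ D, X ⊆ cyclicAllocation n lam rho i) :
    D.card + lam * X.card ≤ lam * (rho + 1) := by
  -- A common worker has cyclic distance less than `rho` from each sub-task in `D`, whereas the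
  -- cover collects the distances `rho, …, n - 1`. The window length `n - rho` is written as a
  -- successor to match `card_cyclicCover`.
  have hdisj : Disjoint X (cyclicCover D rho (n - rho - 1 + 1)) := by
    refine Finset.disjoint_left.2 fun j hj hj' => ?_
    obtain ⟨i, hi, r, hr, e⟩ := mem_cyclicCover.1 hj'
    obtain ⟨r', hr', e'⟩ := mem_cyclicAllocation.1 (h i hi hj)
    have hm : rho + r ≡ r' [MOD n] := by
      refine Nat.ModEq.add_left_cancel' i.val ?_
      rw [← add_assoc]
      exact e.trans e'.symm
    have := Nat.ModEq.eq_of_lt_of_lt hm (by omega) (by omega)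
    omega
  have hne : cyclicCover D rho (n - rho - 1 + 1) ≠ Finset.univ := by
    rintro he
    obtain ⟨x, hx⟩ := hX
    exact Finset.disjoint_left.1 hdisj hx (he ▸ Finset.mem_univ x)
  have h1 := card_cyclicCover hD hne
  have h2 := Finset.card_le_univ (X ∪ cyclicCover D rho (n - rho - 1 + 1))
  rw [Finset.card_union_of_disjoint hdisj, Fintype.card_fin] at h2
  have h3 := card_le_mul_card_cyclicCover D rho
  have h4 : (cyclicCover D rho 1).card + X.card ≤ rho + 1 := by omega
  calc D.card + lam * X.card ≤ lam * ((cyclicCover D rho 1).card + X.card) := by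
        rw [mul_add]; omega
    _ ≤ _ := Nat.mul_le_mul_left _ h4

/-! ### Soundness of the marking rules, termination and correct output -/

section Soundness

variable {p n s u : ℕ} {α : Type*} {N : Fin p → Finset (Fin n)} {T : Fin p → α}
  {M : Finset (Fin n)} {R : Fin p → Fin n → α} {st st' : State p n α} {i j : Fin p} {v : α}
  {W B Wi Bi Wj Bj : Finset (Fin n)}

theorem mem_active {k : Fin n} : k ∈ active N st i ↔ k ∈ N i ∧ k ∉ st.marked := by
  simp [active]

theorem active_mono (h : st.marked ⊆ st'.marked) : active N st' i ⊆ active N st i :=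
  Finset.sdiff_subset_sdiff le_rfl h

theorem Corrupted.mono (h : st.marked ⊆ st'.marked) (hc : Corrupted N R st' i) :
    Corrupted N R st i := by
  obtain ⟨j, hj, k, hk, hne⟩ := hc
  exact ⟨j, active_mono h hj, k, active_mono h hk, hne⟩

/-- The workers marked so far are malicious, the computed results are correct, and no active worker
contradicts them. -/
structure Sound (N : Fin p → Finset (Fin n)) (T : Fin p → α) (M : Finset (Fin n))
    (R : Fin p → Fin n → α) (st : State p n α) : Prop where
  marked_subset : st.marked ⊆ M
  computed_eq : ∀ i v, st.computed i = some v → v = T i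
  active_eq : ∀ i, (st.computed i).isSome → ∀ j ∈ active N st i, R i j = T i

theorem Sound.start : Sound N T M R State.start :=
  ⟨by simp [State.start], by simp [State.start], by simp [State.start]⟩

theorem Sound.mark (h : Sound N T M R st) {X : Finset (Fin n)} (hX : X ⊆ M) :
    Sound N T M R (st.mark X) :=
  ⟨Finset.union_subset h.marked_subset hX, h.computed_eq, fun i hi j hj =>
    h.active_eq i hi j (active_mono Finset.subset_union_left hj)⟩

theorem Sound.not_corrupted (h : Sound N T M R st) (hi : (st.computed i).isSome) :
    ¬ Corrupted N R st i := by
  rintro ⟨j, hj, k, hk, hne⟩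
  exact hne ((h.active_eq i hi j hj).trans (h.active_eq i hi k hk).symm)

theorem IsAttack.mem_of_ne (hA : IsAttack N s T M R) {k : Fin n} (hk : k ∈ active N st i)
    (h : R i k ≠ T i) : k ∈ M :=
  by_contra fun hM => h (hA.2 i k (mem_active.1 hk).1 hM)

theorem le_card_honest (hA : IsAttack N s T M R) (hN : ∀ i, (N i).card = s + u) (i : Fin p) :
    u ≤ (N i \ M).card := by
  have h1 := Finset.le_card_sdiff M (N i)
  have h2 := hN i
  have h3 := hA.1
  omega

theorem Corrupted.exists_ne (hc : Corrupted N R st i) (v : α) :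
    ∃ k ∈ active N st i, R i k ≠ v := by
  obtain ⟨j, hj, k, hk, hne⟩ := hc
  by_cases h : R i j = v
  · exact ⟨k, hk, fun h' => hne (h.trans h'.symm)⟩
  · exact ⟨j, hj, h⟩

theorem active_subset : active N st i ⊆ N i := Finset.sdiff_subset

variable [DecidableEq α]

theorem mem_group {k : Fin n} : k ∈ group N R st i v ↔ k ∈ active N st i ∧ R i k = v := by
  simp [group]

theorem IsAttack.group_subset (hA : IsAttack N s T M R) (h : v ≠ T i) :
    group N R st i v ⊆ M := fun _ hk =>
  hA.mem_of_ne (mem_group.1 hk).1 ((mem_group.1 hk).2.trans_ne h)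

theorem Sound.localCompute (hA : IsAttack N s T M R) (h : Sound N T M R st) (i : Fin p) :
    Sound N T M R (localCompute N T R st i) := by
  have hsub : st.marked ⊆ (ByzantineComputation.localCompute N T R st i).marked :=
    Finset.subset_union_left
  refine ⟨Finset.union_subset h.marked_subset fun k hk => ?_, fun k v hv => ?_,
    fun k hk l hl => ?_⟩
  · rw [Finset.mem_filter] at hk
    exact hA.mem_of_ne hk.1 hk.2
  · by_cases hki : k = i
    · subst hki
      simpa [ByzantineComputation.localCompute, eq_comm] using hv
    · exact h.computed_eq k v (by simpa [ByzantineComputation.localCompute, hki] using hv)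
  · by_cases hki : k = i
    · subst hki
      by_contra hne
      refine (mem_active.1 hl).2 (Finset.mem_union_right _ ?_)
      exact Finset.mem_filter.2 ⟨active_mono hsub hl, hne⟩
    · exact h.active_eq k (by simpa [ByzantineComputation.localCompute, hki] using hk) l
        (active_mono hsub hl)

theorem Sound.honest_subset (hA : IsAttack N s T M R) (h : Sound N T M R st) :
    N i \ M ⊆ group N R st i (T i) := fun k hk => by
  rw [Finset.mem_sdiff] at hk
  exact mem_group.2 ⟨mem_active.2 ⟨hk.1, fun hm => hk.2 (h.marked_subset hm)⟩,
    hA.2 i k hk.1 hk.2⟩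

theorem Sound.le_card_group (hA : IsAttack N s T M R) (hN : ∀ i, (N i).card = s + u)
    (h : Sound N T M R st) (i : Fin p) : u ≤ (group N R st i (T i)).card :=
  (le_card_honest hA hN i).trans (Finset.card_le_card (h.honest_subset hA))

/-! ### Splits -/

theorem Split.disjoint (h : Split N u R st i W B) : Disjoint W B := by
  obtain ⟨v, w, hne, rfl, rfl, -⟩ := h
  refine Finset.disjoint_left.2 fun k hk hk' => hne ?_
  rw [← (mem_group.1 hk).2, (mem_group.1 hk').2]

theorem Split.active_eq (h : Split N u R st i W B) : active N st i = W ∪ B := by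
  obtain ⟨v, w, -, -, -, h, -⟩ := h
  exact h

theorem Split.card_eq (h : Split N u R st i W B) : W.card = u := by
  obtain ⟨v, w, -, -, -, -, h, -⟩ := h
  exact h

theorem Split.left_subset (h : Split N u R st i W B) : W ⊆ active N st i :=
  h.active_eq ▸ Finset.subset_union_left

theorem Split.right_subset (h : Split N u R st i W B) : B ⊆ active N st i :=
  h.active_eq ▸ Finset.subset_union_right

theorem Split.left_nonempty (hu : 1 ≤ u) (h : Split N u R st i W B) : W.Nonempty :=
  Finset.card_pos.1 (by rw [h.card_eq]; omega)

theorem Split.corrupted (hu : 1 ≤ u) (h : Split N u R st i W B) : Corrupted N R st i := by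
  obtain ⟨v, w, hne, rfl, rfl, -, h1, h2⟩ := h
  obtain ⟨j, hj⟩ := Finset.card_pos.1 (show 0 < (group N R st i v).card by omega)
  obtain ⟨k, hk⟩ := Finset.card_pos.1 (show 0 < (group N R st i w).card by omega)
  rw [mem_group] at hj hk
  exact ⟨j, hj.1, k, hk.1, by rw [hj.2, hk.2]; exact hne⟩

theorem Split.card_right (hN : ∀ i, (N i).card = s + u) (h : Split N u R st i W B) :
    B.card + (N i ∩ st.marked).card = s := by
  have h1 : (active N st i).card + (N i ∩ st.marked).card = (N i).card :=
    Finset.card_sdiff_add_card_inter _ _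
  rw [h.active_eq, Finset.card_union_of_disjoint h.disjoint, h.card_eq, hN] at h1
  omega

theorem Split.le_card_right (hN : ∀ i, (N i).card = s + u) (h : Split N u R st i W B) :
    s ≤ st.marked.card + B.card := by
  have h1 := h.card_right hN
  have h2 : (N i ∩ st.marked).card ≤ st.marked.card := Finset.card_le_card Finset.inter_subset_right
  omega

/-- Unless the disagreeing workers are malicious, the agreeing ones are all the remaining malicious
workers. -/
theorem Split.dichotomy (hA : IsAttack N s T M R) (hN : ∀ i, (N i).card = s + u)
    (hs : Sound N T M R st) (h : Split N u R st i W B) : W ⊆ M ∨ B = M \ st.marked := by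
  have hB := h.le_card_right hN
  have hBa := h.right_subset
  obtain ⟨v, w, hne, rfl, rfl, -, -⟩ := h
  by_cases hv : v = T i
  · right
    refine Finset.eq_of_subset_of_card_le (fun k hk => Finset.mem_sdiff.2
      ⟨hA.group_subset (fun hw => hne (hv.trans hw.symm)) hk, (mem_active.1 (hBa hk)).2⟩) ?_
    have h1 := Finset.card_sdiff_add_card_eq_card hs.marked_subset
    have h2 := hA.1
    omega
  · exact Or.inl (hA.group_subset hv)

theorem Split.left_subset_right (hB : Bi = M \ st.marked) (hj : Split N u R st j Wj Bj)
    (hWj : Wj ⊆ M) : Wj ⊆ Bi := fun _ hk =>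
  hB ▸ Finset.mem_sdiff.2 ⟨hWj hk, (mem_active.1 (hj.left_subset hk)).2⟩

/-- Otherwise `Bi` consists of all unmarked malicious workers. Then either `Wj` is malicious and
lies inside `Bi`, or `Bj` is the same set as `Bi`. -/
theorem Split.subset_of_ne_of_not_subset (hA : IsAttack N s T M R)
    (hN : ∀ i, (N i).card = s + u) (hs : Sound N T M R st) (hi : Split N u R st i Wi Bi)
    (hj : Split N u R st j Wj Bj) (hB : Bi ≠ Bj) (h : ¬ Wj ⊆ Bi) : Wi ⊆ M := by
  refine (hi.dichotomy hA hN hs).resolve_right fun hBi => ?_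
  rcases hj.dichotomy hA hN hs with hWj | hBj
  · exact h (hj.left_subset_right hBi hWj)
  · exact hB (hBi.trans hBj.symm)

theorem Split.not_subset_of_not_disjoint (hi : Split N u R st i Wi Bi) (h : ¬ Disjoint Wi Wj) :
    ¬ Wj ⊆ Bi := fun hsub => h (hi.disjoint.mono_right hsub)

theorem Split.not_subset_of_disjoint (hu : 1 ≤ u) (hi : Split N u R st i Wi Bi)
    (hj : Split N u R st j Wj Bj) (h : Disjoint Wj (N i)) : ¬ Wj ⊆ Bi := fun hsub => by
  obtain ⟨k, hk⟩ := hj.left_nonempty hu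
  exact Finset.disjoint_left.1 h hk (active_subset (hi.right_subset (hsub hk)))

/-! ### Classification of the steps -/

/-- A step either marks new malicious workers, or computes a corrupted sub-task when no agreeing set
is too small. -/
def Elementary (N : Fin p → Finset (Fin n)) (u : ℕ) (T : Fin p → α) (M : Finset (Fin n))
    (R : Fin p → Fin n → α) (st st' : State p n α) : Prop :=
  (∃ X ⊆ M, (∃ k ∈ X, k ∉ st.marked) ∧ st' = st.mark X) ∨
    ∃ i, Corrupted N R st i ∧ (∀ st'', ¬ SmallGroupRule N u R st st'') ∧
      st' = localCompute N T R st i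

theorem SmallGroupRule.elementary (hA : IsAttack N s T M R) (hN : ∀ i, (N i).card = s + u)
    (hs : Sound N T M R st) (h : SmallGroupRule N u R st st') : Elementary N u T M R st st' := by
  obtain @⟨i, v, ⟨k, hk⟩, hlt⟩ := h
  refine Or.inl ⟨_, hA.group_subset ?_, ⟨k, hk, (mem_active.1 (mem_group.1 hk).1).2⟩, rfl⟩
  rintro rfl
  have := hs.le_card_group hA hN i
  omega

theorem LargeGroupRule.elementary (hA : IsAttack N s T M R) (hs : Sound N T M R st)
    (h : LargeGroupRule N s R st st') : Elementary N u T M R st st' := by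
  obtain @⟨i, v, hc, hlt⟩ := h
  have hv : v = T i := by
    -- A lying group and the marked workers are disjoint sets of malicious workers, together more
    -- than `s`.
    by_contra hne
    have hdisj : Disjoint st.marked (group N R st i v) :=
      Finset.disjoint_right.2 fun k hk => (mem_active.1 (mem_group.1 hk).1).2
    have := Finset.card_le_card (Finset.union_subset hs.marked_subset
      (hA.group_subset (st := st) hne))
    rw [Finset.card_union_of_disjoint hdisj] at this
    have := hA.1
    omega
  obtain ⟨k, hk, hkv⟩ := hc.exists_ne v
  refine Or.inl ⟨_, fun l hl => ?_, ⟨k, ?_, (mem_active.1 hk).2⟩, rfl⟩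
  · simp only [Finset.mem_sdiff, mem_group, not_and] at hl
    exact hA.mem_of_ne hl.1 (hv ▸ hl.2 hl.1)
  · simp [mem_group, hk, hkv]

theorem PairRule.elementary (hu : 1 ≤ u) (hA : IsAttack N s T M R)
    (hN : ∀ i, (N i).card = s + u) (hs : Sound N T M R st)
    (hsmall : ∀ st'', ¬ SmallGroupRule N u R st st'') (h : PairRule N u T R st st') :
    Elementary N u T M R st st' := by
  have new : ∀ {i W B}, Split N u R st i W B → ∃ k ∈ W, k ∉ st.marked := fun hi => by
    obtain ⟨k, hk⟩ := hi.left_nonempty hu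
    exact ⟨k, hk, (mem_active.1 (hi.left_subset hk)).2⟩
  have newU : ∀ {i W B} (W' : Finset (Fin n)), Split N u R st i W B →
      ∃ k ∈ W ∪ W', k ∉ st.marked := fun W' hi => by
    obtain ⟨k, hk, h⟩ := new hi
    exact ⟨k, Finset.mem_union_left _ hk, h⟩
  cases h with
  | same i j Wi Bi Wj Bj hij hi hj hW hB =>
    refine Or.inl ⟨_, ?_, new hi, rfl⟩
    refine hi.subset_of_ne_of_not_subset hA hN hs hj hB
      (hi.not_subset_of_not_disjoint ?_)
    obtain ⟨k, hk⟩ := hi.left_nonempty hu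
    exact Finset.not_disjoint_iff.2 ⟨k, hk, hW ▸ hk⟩
  | overlapCompute i j Wi Bi Wj Bj hij hi hj hW hWW hB =>
    exact Or.inr ⟨i, hi.corrupted hu, hsmall, rfl⟩
  | overlapMark i j Wi Bi Wj Bj hij hi hj hW hWW hB =>
    refine Or.inl ⟨_, Finset.union_subset ?_ ?_, newU _ hi, rfl⟩
    · exact hi.subset_of_ne_of_not_subset hA hN hs hj hB (hi.not_subset_of_not_disjoint hWW)
    · exact hj.subset_of_ne_of_not_subset hA hN hs hi hB.symm
        (hj.not_subset_of_not_disjoint fun h => hWW h.symm)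
  | disjointMark i j Wi Bi Wj Bj hij hi hj hWW hWj hWi =>
    refine Or.inl ⟨_, ?_, new hi, rfl⟩
    by_cases hB : Bi = Bj
    -- A worker of `Wi` allotted `j` is active there, so it lies in `Wj` or in `Bj = Bi`, and `Wi`
    -- is disjoint from both.
    · refine absurd (Finset.disjoint_left.2 fun k hk hkj => ?_) hWi
      have hkj' : k ∈ active N st j := mem_active.2 ⟨hkj, (mem_active.1 (hi.left_subset hk)).2⟩
      rw [hj.active_eq, Finset.mem_union] at hkj'
      rcases hkj' with h | h
      · exact Finset.disjoint_left.1 hWW hk h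
      · exact Finset.disjoint_left.1 hi.disjoint hk (hB ▸ h)
    · exact hi.subset_of_ne_of_not_subset hA hN hs hj hB fun h =>
        hWj ((h.trans hi.right_subset).trans active_subset)
  | apartCompute i j Wi Bi Wj Bj hij hi hj hWi hWj hB =>
    exact Or.inr ⟨i, hi.corrupted hu, hsmall, rfl⟩
  | apartMark i j Wi Bi Wj Bj hij hi hj hWi hWj hB =>
    refine Or.inl ⟨_, Finset.union_subset ?_ ?_, newU _ hi, rfl⟩
    · exact hi.subset_of_ne_of_not_subset hA hN hs hj hB (hi.not_subset_of_disjoint hu hj hWj)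
    · exact hj.subset_of_ne_of_not_subset hA hN hs hi hB.symm
        (hj.not_subset_of_disjoint hu hi hWi)

theorem disagreement_le (v : α) :
    disagreement N R st i ≤ (active N st i).card - (group N R st i v).card := by
  refine Nat.sub_le_sub_left ?_ _
  rcases (group N R st i v).eq_empty_or_nonempty with h | ⟨k, hk⟩
  · simp [h]
  · rw [mem_group] at hk
    have := Finset.le_sup (f := fun j => (group N R st i (R i j)).card) hk.1
    simpa [hk.2] using this

theorem exists_disagreement_eq (h : (active N st i).Nonempty) : ∃ k ∈ active N st i,
    disagreement N R st i = (active N st i).card - (group N R st i (R i k)).card := by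
  obtain ⟨k, hk, he⟩ :=
    Finset.exists_mem_eq_sup _ h fun j => (group N R st i (R i j)).card
  exact ⟨k, hk, by rw [disagreement, he]⟩

theorem card_sdiff_group (v : α) : (active N st i \ group N R st i v).card =
    (active N st i).card - (group N R st i v).card :=
  Finset.card_sdiff_of_subset (Finset.filter_subset _ _)

theorem corrupted_of_disagreement_pos (h : 0 < disagreement N R st i) : Corrupted N R st i := by
  by_contra hc
  have hne : (active N st i).Nonempty := by
    rw [Finset.nonempty_iff_ne_empty]
    intro he
    simp [disagreement, he] at h
  obtain ⟨k, hk⟩ := hne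
  have hle := disagreement_le (N := N) (R := R) (st := st) (i := i) (R i k)
  have : group N R st i (R i k) = active N st i := by
    refine Finset.filter_true_of_mem fun l hl => ?_
    by_contra hlk
    exact hc ⟨l, hl, k, hk, hlk⟩
  rw [this] at hle
  omega

/-- Fix the value of a largest agreeing set of the old state: marking can only remove dissenters
from this value. -/
theorem disagreement_mono (h : st.marked ⊆ st'.marked) :
    disagreement N R st' i ≤ disagreement N R st i := by
  rcases (active N st' i).eq_empty_or_nonempty with he | hne
  · simp [disagreement, he]
  · obtain ⟨k, -, hk⟩ := exists_disagreement_eq (R := R) (hne.mono (active_mono (N := N) h))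
    refine (disagreement_le (R i k)).trans ?_
    rw [hk, ← card_sdiff_group, ← card_sdiff_group]
    refine Finset.card_le_card fun l hl => ?_
    simp only [Finset.mem_sdiff, mem_group, not_and] at hl ⊢
    exact ⟨active_mono h hl.1, fun _ => hl.2 hl.1⟩

theorem LogicStage.disagreement_le (h : LogicStage N u R st) (i : Fin p) :
    disagreement N R st i ≤ u := by
  by_contra hlt
  exact hlt (h.2 i (corrupted_of_disagreement_pos (by omega)))

theorem Step.elementary (hu : 1 ≤ u) (hA : IsAttack N s T M R) (hN : ∀ i, (N i).card = s + u)
    (hs : Sound N T M R st) (h : Step N s u T R st st') : Elementary N u T M R st st' := by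
  cases h with
  | small _ h => exact h.elementary hA hN hs
  | greedy i hsmall hmax hgt =>
    exact Or.inr ⟨i, corrupted_of_disagreement_pos (by omega), hsmall, rfl⟩
  | large _ hst h => exact h.elementary hA hs
  | pair _ hst hlarge h => exact h.elementary hu hA hN hs hst.1
  | last i hst hlarge hpair hi => exact Or.inr ⟨i, hi, hst.1, rfl⟩

theorem Step.sound (hu : 1 ≤ u) (hA : IsAttack N s T M R) (hN : ∀ i, (N i).card = s + u)
    (hs : Sound N T M R st) (h : Step N s u T R st st') : Sound N T M R st' := by
  rcases h.elementary hu hA hN hs with ⟨X, hX, -, rfl⟩ | ⟨i, -, -, rfl⟩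
  · exact hs.mark hX
  · exact hs.localCompute hA i

theorem localCompute_card (st : State p n α) (i : Fin p) :
    (localCompute N T R st i).marked.card =
      st.marked.card + ((active N st i).card - (group N R st i (T i)).card) := by
  have : (active N st i).filter (fun j => R i j ≠ T i) =
      active N st i \ group N R st i (T i) := by
    rw [group, Finset.filter_not]
  rw [localCompute, ← card_sdiff_group, this, Finset.card_union_of_disjoint]
  exact Finset.disjoint_right.2 fun k hk => (mem_active.1 (Finset.mem_sdiff.1 hk).1).2

/-- If no agreeing set has fewer than `u` workers, a local computation of a corrupted sub-task
reveals at least `u` malicious workers. -/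
theorem Corrupted.card_le_localCompute (hc : Corrupted N R st i)
    (hsmall : ∀ st'', ¬ SmallGroupRule N u R st st'') :
    st.marked.card + u ≤ (localCompute N T R st i).marked.card := by
  rw [localCompute_card, ← card_sdiff_group]
  obtain ⟨k, hk, hne⟩ := hc.exists_ne (T i)
  have hg : u ≤ (group N R st i (R i k)).card := by
    by_contra hlt
    exact hsmall _ (.mk st i (R i k) ⟨k, mem_group.2 ⟨hk, rfl⟩⟩ (by omega))
  refine Nat.add_le_add_left (hg.trans (Finset.card_le_card fun l hl => ?_)) _
  rw [mem_group] at hl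
  simp [mem_group, hl.1, hl.2, hne]

theorem Step.marked_subset (hu : 1 ≤ u) (hA : IsAttack N s T M R)
    (hN : ∀ i, (N i).card = s + u) (hs : Sound N T M R st) (h : Step N s u T R st st') :
    st.marked ⊆ st'.marked := by
  rcases h.elementary hu hA hN hs with ⟨X, -, -, rfl⟩ | ⟨i, -, -, rfl⟩ <;>
    exact Finset.subset_union_left

theorem Step.card_lt (hu : 1 ≤ u) (hA : IsAttack N s T M R)
    (hN : ∀ i, (N i).card = s + u) (hs : Sound N T M R st) (h : Step N s u T R st st') :
    st.marked.card < st'.marked.card := by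
  rcases h.elementary hu hA hN hs with ⟨X, -, ⟨k, hk, hkm⟩, rfl⟩ | ⟨i, hc, hsmall, rfl⟩
  · refine Finset.card_lt_card ⟨Finset.subset_union_left, fun hsub => hkm ?_⟩
    exact hsub (Finset.mem_union_right _ hk)
  · have := hc.card_le_localCompute (T := T) hsmall
    omega

theorem Sound.of_reflTransGen (hu : 1 ≤ u) (hA : IsAttack N s T M R)
    (hN : ∀ i, (N i).card = s + u)
    (h : Relation.ReflTransGen (Step N s u T R) State.start st) : Sound N T M R st := by
  induction h with
  | refl => exact Sound.start
  | tail _ hstep ih => exact hstep.sound hu hA hN ih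

/-- Every run is finite. -/
theorem no_infinite_run (hu : 1 ≤ u) (hA : IsAttack N s T M R) (hN : ∀ i, (N i).card = s + u) :
    ¬ ∃ run : ℕ → State p n α, run 0 = State.start ∧
      ∀ t, Step N s u T R (run t) (run (t + 1)) := by
  rintro ⟨run, h0, hrun⟩
  -- The number of marked workers grows with every step but cannot exceed `n`.
  have key : ∀ t, Sound N T M R (run t) ∧ t ≤ (run t).marked.card := by
    intro t
    induction t with
    | zero => exact ⟨h0 ▸ Sound.start, Nat.zero_le _⟩
    | succ t ih =>
      have := (hrun t).card_lt hu hA hN ih.1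
      exact ⟨(hrun t).sound hu hA hN ih.1, by omega⟩
  have h1 := (key (n + 1)).2
  have h2 := Finset.card_le_univ (run (n + 1)).marked
  rw [Fintype.card_fin] at h2
  omega

/-- When no step is possible, the central node outputs the true results. -/
theorem Sound.outputs (hu : 1 ≤ u) (hA : IsAttack N s T M R) (hN : ∀ i, (N i).card = s + u)
    (hs : Sound N T M R st) (hfinal : ∀ st', ¬ Step N s u T R st st') (i : Fin p) :
    Outputs N R st i (T i) := by
  have hsmall : ∀ st', ¬ SmallGroupRule N u R st st' := fun st' h => hfinal _ (.small _ _ h)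
  have hlogic : LogicStage N u R st := by
    refine ⟨hsmall, fun k _ => ?_⟩
    by_contra hlt
    obtain ⟨l, -, hl⟩ := Finset.exists_max_image Finset.univ (fun k => disagreement N R st k)
      ⟨k, Finset.mem_univ k⟩
    have hkl := hl k (Finset.mem_univ k)
    exact hfinal _ (.greedy _ l hsmall (fun k => hl k (Finset.mem_univ k)) (by omega))
  have hlarge : ∀ st', ¬ LargeGroupRule N s R st st' := fun st' h =>
    hfinal _ (.large _ _ hlogic h)
  have hpair : ∀ st', ¬ PairRule N u T R st st' := fun st' h =>
    hfinal _ (.pair _ _ hlogic hlarge h)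
  have hnc : ¬ Corrupted N R st i := fun h => hfinal _ (.last _ i hlogic hlarge hpair h)
  obtain ⟨k, hk⟩ := Finset.card_pos.1 (hu.trans (hs.le_card_group hA hN i))
  rw [mem_group] at hk
  cases hv : st.computed i with
  | some v => exact Or.inl (hv.trans (by rw [hs.computed_eq i v hv]))
  | none =>
    refine Or.inr ⟨hv, ⟨k, hk.1⟩, fun l hl => ?_⟩
    by_contra hne
    exact hnc ⟨l, hl, k, hk.1, fun h => hne (h.trans hk.2)⟩

end Soundness

/-! ### Counting local computations -/

section Cost

variable {p n s u : ℕ} {α : Type*} {N : Fin p → Finset (Fin n)} {T : Fin p → α}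
  {M : Finset (Fin n)} {R : Fin p → Fin n → α} {st st' st₀ : State p n α} {i j : Fin p} {v : α}
  {W B Wi Bi Wj Bj : Finset (Fin n)}

/-- The reports of the active workers partition them in the same way for `i` and `j`. -/
def SamePartition (N : Fin p → Finset (Fin n)) (R : Fin p → Fin n → α) (st : State p n α)
    (i j : Fin p) : Prop :=
  active N st i = active N st j ∧
    ∀ k ∈ active N st i, ∀ l ∈ active N st i, R i k = R i l ↔ R j k = R j l

theorem SamePartition.symm (h : SamePartition N R st i j) : SamePartition N R st j i :=
  ⟨h.1.symm, fun k hk l hl => (h.2 k (h.1 ▸ hk) l (h.1 ▸ hl)).symm⟩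

theorem SamePartition.corrupted (h : SamePartition N R st₀ i j)
    (hm : st₀.marked ⊆ st.marked) (hc : Corrupted N R st i) : Corrupted N R st j := by
  obtain ⟨k, hk, l, hl, hne⟩ := hc
  have mem : ∀ {k}, k ∈ active N st i → k ∈ active N st j := fun {k} hk =>
    mem_active.2 ⟨(mem_active.1 (h.1 ▸ active_mono hm hk)).1, (mem_active.1 hk).2⟩
  exact ⟨k, mem hk, l, mem hl, fun he =>
    hne ((h.2 k (active_mono hm hk) l (active_mono hm hl)).2 he)⟩

/-- The sub-tasks computed between `st₀` and `st`. -/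
def computedSince (st₀ st : State p n α) : Finset (Fin p) :=
  Finset.univ.filter fun i => (st.computed i).isSome ∧ ¬ (st₀.computed i).isSome

theorem mem_computedSince : i ∈ computedSince st₀ st ↔
    (st.computed i).isSome ∧ ¬ (st₀.computed i).isSome := by
  simp [computedSince]

theorem cost_le_add_card (st₀ st : State p n α) :
    st.cost ≤ st₀.cost + (computedSince st₀ st).card := by
  refine (Finset.card_le_card fun i hi => ?_).trans (Finset.card_union_le _ _)
  rw [Finset.mem_filter] at hi
  simp only [Finset.mem_union, Finset.mem_filter, mem_computedSince, Finset.mem_univ, true_and,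
    hi.2]
  exact em _

/-- The sub-tasks computed since `st₀` were corrupted and pairwise essentially different then. -/
structure Descends (N : Fin p → Finset (Fin n)) (R : Fin p → Fin n → α)
    (st₀ st : State p n α) : Prop where
  marked_subset : st₀.marked ⊆ st.marked
  corrupted : ∀ i ∈ computedSince st₀ st, Corrupted N R st₀ i
  not_samePartition : ∀ i ∈ computedSince st₀ st, ∀ j ∈ computedSince st₀ st, i ≠ j →
    ¬ SamePartition N R st₀ i j

theorem Descends.refl (st : State p n α) : Descends N R st st :=
  ⟨le_rfl, fun _ hi => absurd (mem_computedSince.1 hi).1 (mem_computedSince.1 hi).2,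
    fun _ hi => absurd (mem_computedSince.1 hi).1 (mem_computedSince.1 hi).2⟩

variable [DecidableEq α]

theorem cost_localCompute_le (st : State p n α) (i : Fin p) :
    (localCompute N T R st i).cost ≤ st.cost + 1 := by
  refine (Finset.card_le_card (t := insert i (Finset.univ.filter fun k =>
    (st.computed k).isSome)) fun k hk => ?_).trans (Finset.card_insert_le _ _)
  by_cases hki : k = i
  · simp [hki]
  · simpa [localCompute, hki] using hk

theorem Step.cost_mul_le (hu : 1 ≤ u) (hA : IsAttack N s T M R)
    (hN : ∀ i, (N i).card = s + u) (hs : Sound N T M R st) (h : Step N s u T R st st')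
    (hc : st.cost * u ≤ st.marked.card) : st'.cost * u ≤ st'.marked.card := by
  have hlt := h.card_lt hu hA hN hs
  rcases h.elementary hu hA hN hs with ⟨X, -, -, rfl⟩ | ⟨i, hi, hsmall, rfl⟩
  · exact hc.trans hlt.le
  · have h1 := hi.card_le_localCompute (T := T) hsmall
    have h2 := Nat.mul_le_mul_right u (cost_localCompute_le (N := N) (T := T) (R := R) st i)
    rw [add_mul, one_mul] at h2
    omega

/-- No step from `st` is a local computation. -/
def Idle (N : Fin p → Finset (Fin n)) (s u : ℕ) (T : Fin p → α) (R : Fin p → Fin n → α)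
    (st : State p n α) : Prop :=
  ∀ st', Step N s u T R st st' → st'.cost = st.cost

theorem SmallGroupRule.cost_eq (h : SmallGroupRule N u R st st') : st'.cost = st.cost := by
  cases h; rfl

theorem LargeGroupRule.cost_eq (h : LargeGroupRule N s R st st') : st'.cost = st.cost := by
  cases h; rfl

theorem idle_of_smallGroupRule (h : SmallGroupRule N u R st st') : Idle N s u T R st := by
  intro st'' hstep
  cases hstep with
  | small _ h' => exact h'.cost_eq
  | greedy i hsmall => exact absurd h (hsmall _)
  | large _ hst _ => exact absurd h (hst.1 _)
  | pair _ hst _ _ => exact absurd h (hst.1 _)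
  | last i hst _ _ _ => exact absurd h (hst.1 _)

theorem idle_of_largeGroupRule (hd : ∀ i, disagreement N R st i ≤ u)
    (h : LargeGroupRule N s R st st') : Idle N s u T R st := by
  intro st'' hstep
  cases hstep with
  | small _ h' => exact h'.cost_eq
  | greedy i _ _ hgt => exact absurd (hd i) (by omega)
  | large _ _ h' => exact h'.cost_eq
  | pair _ _ hlarge _ => exact absurd h (hlarge _)
  | last i _ hlarge _ _ => exact absurd h (hlarge _)

theorem idle_of_subset_marked (hu : 1 ≤ u) (hA : IsAttack N s T M R)
    (hN : ∀ i, (N i).card = s + u) (hs : Sound N T M R st) (hM : M ⊆ st.marked) :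
    Idle N s u T R st := by
  intro st' hstep
  rcases hstep.elementary hu hA hN hs with ⟨X, -, -, rfl⟩ | ⟨i, hc, -, rfl⟩
  · rfl
  · obtain ⟨k, hk, hne⟩ := hc.exists_ne (T i)
    exact absurd (hM (hA.mem_of_ne hk hne)) (mem_active.1 hk).2

/-- The local computation of a sub-task either identifies all malicious workers, or marks exactly
the disagreeing workers. -/
theorem Split.localCompute_marked (hA : IsAttack N s T M R) (hN : ∀ i, (N i).card = s + u)
    (hu : 1 ≤ u) (hs : Sound N T M R st) (h : Split N u R st i W B) :
    M ⊆ (localCompute N T R st i).marked ∨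
      (localCompute N T R st i).marked = st.marked ∪ W := by
  have hact := h.active_eq
  have hdisj := h.disjoint
  have hdich := h.dichotomy hA hN hs
  obtain ⟨k, hk⟩ := Finset.card_pos.1 (hu.trans (le_card_honest hA hN i))
  have hkT := mem_group.1 (hs.honest_subset hA hk)
  have hkM := (Finset.mem_sdiff.1 hk).2
  have hkWB := hkT.1
  obtain ⟨v, w, hne, rfl, rfl, -, -, -⟩ := h
  have mem : ∀ l, l ∈ (localCompute N T R st i).marked ↔
      l ∈ st.marked ∨ (l ∈ group N R st i v ∨ l ∈ group N R st i w) ∧ R i l ≠ T i := fun l => by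
    rw [← Finset.mem_union, ← hact, localCompute, Finset.mem_union, Finset.mem_filter]
  rw [hact, Finset.mem_union] at hkWB
  rcases hkWB with hkW | hkB
  · have hv : v = T i := (mem_group.1 hkW).2.symm.trans hkT.2
    have hB := hdich.resolve_left fun hsub => hkM (hsub hkW)
    refine Or.inl fun l hl => (mem l).2 ?_
    by_cases hlm : l ∈ st.marked
    · exact Or.inl hlm
    · have hlB : l ∈ group N R st i w := hB ▸ Finset.mem_sdiff.2 ⟨hl, hlm⟩
      exact Or.inr ⟨Or.inr hlB, by rw [(mem_group.1 hlB).2, ← hv]; exact hne.symm⟩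
  · have hw : w = T i := (mem_group.1 hkB).2.symm.trans hkT.2
    right
    ext l
    rw [mem, Finset.mem_union]
    refine or_congr_right ⟨fun hl => hl.1.resolve_right fun hl' => hl.2 ?_, fun hl => ⟨Or.inl hl, ?_⟩⟩
    · rw [(mem_group.1 hl').2, hw]
    · rw [(mem_group.1 hl).2, ← hw]; exact hne

/-- After a local computation by one of the pair rules, further malicious workers can be marked
without another local computation. -/
theorem PairRule.idle (hu : 1 ≤ u) (hA : IsAttack N s T M R)
    (hN : ∀ i, (N i).card = s + u) (hs : Sound N T M R st) (hst : LogicStage N u R st)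
    (h : PairRule N u T R st st') : st'.cost = st.cost ∨ Idle N s u T R st' := by
  cases h with
  | same => exact Or.inl rfl
  | overlapMark => exact Or.inl rfl
  | disjointMark => exact Or.inl rfl
  | apartMark => exact Or.inl rfl
  | overlapCompute i j Wi Bi Wj Bj hij hi hj hW hWW hB =>
    right
    rcases hi.localCompute_marked hA hN hu hs with hM | hm
    · exact idle_of_subset_marked hu hA hN (hs.localCompute hA i) hM
    · have hcard : Wi.card = Wj.card := hi.card_eq.trans hj.card_eq.symm
      have hju := hj.card_eq
      have hja := hj.left_subset
      obtain ⟨v, -, -, rfl, -⟩ := hj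
      -- What is left of `Wj` is nonempty, since `Wi ≠ Wj` have equal size, and has fewer than `u`
      -- members, since they overlap. So the rule for small groups takes precedence over any
      -- computation.
      have hg : group N R (localCompute N T R st i) j v = group N R st j v \ Wi := by
        ext l
        simp only [mem_group, mem_active, hm, Finset.mem_sdiff, Finset.mem_union]
        tauto
      refine idle_of_smallGroupRule (.mk _ j v ?_ ?_)
      · rw [hg, Finset.sdiff_nonempty]
        exact fun hsub => hW (Finset.eq_of_subset_of_card_le hsub hcard.le).symm
      · obtain ⟨l, hl, hl'⟩ := Finset.not_disjoint_iff.1 hWW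
        rw [hg, ← hju]
        exact Finset.card_lt_card ⟨Finset.sdiff_subset, fun hsub =>
          (Finset.mem_sdiff.1 (hsub hl')).2 hl⟩
  | apartCompute i j Wi Bi Wj Bj hij hi hj hWi hWj hB =>
    right
    rcases hi.localCompute_marked hA hN hu hs with hM | hm
    · exact idle_of_subset_marked hu hA hN (hs.localCompute hA i) hM
    · have hact : active N (localCompute N T R st i) j = active N st j := by
        ext l
        simp only [mem_active, hm, Finset.mem_union, not_or]
        exact ⟨fun hl => ⟨hl.1, hl.2.1⟩, fun hl => ⟨hl.1, hl.2, fun hlW =>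
          Finset.disjoint_left.1 hWi hlW hl.1⟩⟩
      obtain ⟨k, hk, l, hl, hkl⟩ := hj.corrupted hu
      have hBj := hj.le_card_right hN
      obtain ⟨v, w, -, -, rfl, -, -, -⟩ := hj
      have hg : group N R (localCompute N T R st i) j w = group N R st j w := by
        rw [group, hact, group]
      have hcard : (st.marked ∪ Wi).card = st.marked.card + u := by
        rw [Finset.card_union_of_disjoint, hi.card_eq]
        exact Finset.disjoint_right.2 fun l hl => (mem_active.1 (hi.left_subset hl)).2
      -- No worker of `Wi` is allotted `j`, so `Bj` keeps its size, at least `s` minus the old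
      -- number of marked workers, while `u` more are marked. It is now too large to be malicious.
      refine idle_of_largeGroupRule
        (fun l => (disagreement_mono Finset.subset_union_left).trans (hst.disagreement_le l))
        (.mk _ j w ⟨k, hact ▸ hk, l, hact ▸ hl, hkl⟩ ?_)
      rw [hg, hm, hcard]
      omega

/-- The balance between local computations and marked workers before the second loop of the
logic-based protocol: each local computation costs at least `u + 1` malicious workers. -/
def Balanced (N : Fin p → Finset (Fin n)) (s u : ℕ) (T : Fin p → α) (R : Fin p → Fin n → α)
    (st : State p n α) : Prop :=
  st.cost * (u + 1) ≤ st.marked.card ∨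
    st.cost * (u + 1) ≤ st.marked.card + 1 ∧ Idle N s u T R st

/-- The new marked worker repays the deficit of one allowed by the second alternative of `Balanced`.
-/
theorem Balanced.of_cost_eq (hb : Balanced N s u T R st) (hc : st'.cost = st.cost)
    (hlt : st.marked.card < st'.marked.card) : Balanced N s u T R st' := by
  left
  rw [hc]
  rcases hb with hb | ⟨hb, -⟩ <;> omega

/-- A deficit is allowed only in an `Idle` state, where no computation can start; hence deficits
never accumulate. -/
theorem Balanced.cost_mul_le (hb : Balanced N s u T R st) (h : Step N s u T R st st')
    (hc : st'.cost ≠ st.cost) : st.cost * (u + 1) ≤ st.marked.card :=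
  hb.resolve_right fun h' => hc (h'.2 _ h)

/-- Entry into the second loop of the logic-based protocol. -/
structure SecondLoop (N : Fin p → Finset (Fin n)) (s u : ℕ) (T : Fin p → α)
    (R : Fin p → Fin n → α) (st : State p n α) : Prop where
  logic : LogicStage N u R st
  not_large : ∀ st', ¬ LargeGroupRule N s R st st'
  not_pair : ∀ st', ¬ PairRule N u T R st st'

theorem Balanced.step (hu : 1 ≤ u) (hA : IsAttack N s T M R) (hN : ∀ i, (N i).card = s + u)
    (hs : Sound N T M R st) (hb : Balanced N s u T R st) (h : Step N s u T R st st') :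
    Balanced N s u T R st' ∨
      SecondLoop N s u T R st ∧ st.cost * (u + 1) ≤ st.marked.card := by
  have hlt := h.card_lt hu hA hN hs
  by_cases hc : st'.cost = st.cost
  · exact Or.inl (hb.of_cost_eq hc hlt)
  have hcm := hb.cost_mul_le h hc
  have bound : ∀ i, (localCompute N T R st i).cost * (u + 1) ≤ st.cost * (u + 1) + (u + 1) :=
    fun i => by
      have := Nat.mul_le_mul_right (u + 1) (cost_localCompute_le (N := N) (T := T) (R := R) st i)
      rwa [add_mul, one_mul] at this
  cases h with
  | small _ h => exact absurd h.cost_eq hc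
  | greedy i hsmall hmax hgt =>
    left
    left
    have h1 := localCompute_card (N := N) (T := T) (R := R) st i
    have h2 := disagreement_le (N := N) (R := R) (st := st) (i := i) (T i)
    have h3 := bound i
    omega
  | large _ hst h => exact absurd h.cost_eq hc
  | pair _ hst hlarge h =>
    left
    right
    refine ⟨?_, (h.idle hu hA hN hs hst).resolve_left hc⟩
    rcases h.elementary hu hA hN hs hst.1 with ⟨X, -, -, rfl⟩ | ⟨i, hi, hsmall, rfl⟩
    · exact absurd rfl hc
    · have h1 := hi.card_le_localCompute (T := T) hsmall
      have h3 := bound i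
      omega
  | last i hst hlarge hpair hi => exact Or.inr ⟨⟨hst, hlarge, hpair⟩, hcm⟩

/-! ### The second loop of the logic-based protocol -/

/-- Marking only removes active workers, so whatever is corrupted later was corrupted in `st₀`. Once
a sub-task is computed, its active workers agree, and so do those of every sub-task with the same
partition in `st₀`; none of these is computed afterwards. It does not matter which rule makes the
computation. -/
theorem Descends.step (hu : 1 ≤ u) (hA : IsAttack N s T M R) (hN : ∀ i, (N i).card = s + u)
    (hs : Sound N T M R st) (hd : Descends N R st₀ st) (h : Step N s u T R st st') :
    Descends N R st₀ st' := by
  have hm := hd.marked_subset.trans (h.marked_subset hu hA hN hs)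
  rcases h.elementary hu hA hN hs with ⟨X, -, -, rfl⟩ | ⟨i, hc, -, rfl⟩
  · exact ⟨hm, hd.corrupted, hd.not_samePartition⟩
  have hmem : ∀ k ∈ computedSince st₀ (localCompute N T R st i),
      k = i ∨ k ∈ computedSince st₀ st := by
    intro k hk
    by_cases hki : k = i
    · exact Or.inl hki
    · rw [mem_computedSince] at hk ⊢
      exact Or.inr ⟨by simpa [localCompute, hki] using hk.1, hk.2⟩
  have hnew : ∀ k ∈ computedSince st₀ st, ¬ SamePartition N R st₀ i k := fun k hk hp =>
    hs.not_corrupted (mem_computedSince.1 hk).1 (hp.corrupted hd.marked_subset hc)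
  refine ⟨hm, fun k hk => ?_, fun k hk l hl hkl => ?_⟩
  · rcases hmem k hk with rfl | hk
    · exact hc.mono hd.marked_subset
    · exact hd.corrupted k hk
  · rcases hmem k hk with rfl | hk' <;> rcases hmem l hl with rfl | hl'
    · exact absurd rfl hkl
    · exact hnew l hl'
    · exact fun hp => hnew k hk' hp.symm
    · exact hd.not_samePartition k hk' l hl' hkl

/-- In the logic-based protocol every corrupted sub-task is split into two agreeing sets. -/
theorem LogicStage.exists_split (h : LogicStage N u R st) (hc : Corrupted N R st i) :
    ∃ W B, Split N u R st i W B := by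
  have hge : ∀ k ∈ active N st i, u ≤ (group N R st i (R i k)).card := fun k hk => by
    by_contra hlt
    exact h.1 _ (.mk st i (R i k) ⟨k, mem_group.2 ⟨hk, rfl⟩⟩ (by omega))
  have hd := h.2 i hc
  have hne : (active N st i).Nonempty := by
    obtain ⟨j, hj, -⟩ := hc
    exact ⟨j, hj⟩
  obtain ⟨b, hb, hbd⟩ := exists_disagreement_eq (R := R) hne
  obtain ⟨a, ha, hab⟩ := hc.exists_ne (R i b)
  have hsub : group N R st i (R i a) ⊆ active N st i \ group N R st i (R i b) := fun l hl => by
    rw [mem_group] at hl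
    simp [mem_group, hl.1, hl.2, hab]
  rw [hbd, ← card_sdiff_group] at hd
  -- The complement of a largest group has at most `u` members and contains a dissenting group of at
  -- least `u`, so the two coincide.
  have hW : group N R st i (R i a) = active N st i \ group N R st i (R i b) :=
    Finset.eq_of_subset_of_card_le hsub (hd.trans (hge a ha))
  refine ⟨_, _, R i a, R i b, hab, rfl, rfl, ?_,
    le_antisymm (hW ▸ hd) (hge a ha), hge b hb⟩
  rw [hW, Finset.sdiff_union_of_subset]
  exact Finset.filter_subset _ _

theorem Split.samePartition (hi : Split N u R st i W B) (hj : Split N u R st j W B) :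
    SamePartition N R st i j := by
  have key : ∀ {i}, Split N u R st i W B → ∀ k ∈ active N st i, ∀ l ∈ active N st i,
      R i k = R i l ↔ (k ∈ W ↔ l ∈ W) := by
    intro i hi k hk l hl
    have hd := hi.disjoint
    rw [hi.active_eq, Finset.mem_union] at hk hl
    obtain ⟨v, w, hne, rfl, rfl, -⟩ := hi
    rw [Finset.disjoint_left] at hd
    rcases hk with hk | hk <;> rcases hl with hl | hl
    · simp only [hk, hl, iff_self, iff_true]
      exact (mem_group.1 hk).2.trans (mem_group.1 hl).2.symm
    · simp only [hk, show l ∉ group N R st i v from fun h => hd h hl, iff_false,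
        not_true_eq_false]
      rw [(mem_group.1 hk).2, (mem_group.1 hl).2]
      exact hne
    · simp only [hl, iff_true, show k ∉ group N R st i v from fun h => hd h hk, iff_false]
      rw [(mem_group.1 hk).2, (mem_group.1 hl).2]
      exact hne.symm
    · simp only [show l ∉ group N R st i v from fun h => hd h hl,
        show k ∉ group N R st i v from fun h => hd h hk, iff_true]
      exact (mem_group.1 hk).2.trans (mem_group.1 hl).2.symm
  have hact : active N st i = active N st j := hi.active_eq.trans hj.active_eq.symm
  exact ⟨hact, fun k hk l hl => (key hi k hk l hl).trans
    (key hj k (hact ▸ hk) l (hact ▸ hl)).symm⟩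

/-- Since `B` is not too large, `|marked| + |B| ≤ s`; but counting the workers of `i` gives `|N i ∩
marked| + |B| = s`. -/
theorem SecondLoop.marked_subset (hu : 1 ≤ u) (hN : ∀ i, (N i).card = s + u)
    (h : SecondLoop N s u T R st) (hi : Split N u R st i W B) : st.marked ⊆ N i := by
  have hle : st.marked.card + B.card ≤ s := by
    have hc := hi.corrupted hu
    obtain ⟨v, w, -, -, rfl, -⟩ := hi
    by_contra hlt
    exact h.not_large _ (.mk st i w hc (by omega))
  have h1 := hi.card_right hN
  rw [← Finset.inter_eq_right]
  exact Finset.eq_of_subset_of_card_le Finset.inter_subset_right (by omega)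

theorem SecondLoop.relation (h : SecondLoop N s u T R st) (hij : i ≠ j)
    (hi : Split N u R st i Wi Bi) (hj : Split N u R st j Wj Bj) :
    (Wi = Wj ∧ Bi = Bj) ∨ (Disjoint Wi Wj ∧ Wi ⊆ N j ∧ Wj ⊆ N i) := by
  by_cases hW : Wi = Wj
  · by_cases hB : Bi = Bj
    · exact Or.inl ⟨hW, hB⟩
    · exact absurd (.same st i j Wi Bi Wj Bj hij hi hj hW hB) (h.not_pair _)
  by_cases hWW : Disjoint Wi Wj
  · right
    have h1 : ∀ {i j Wi Bi Wj Bj}, i ≠ j → Split N u R st i Wi Bi → Split N u R st j Wj Bj →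
        Disjoint Wi Wj → ¬ Disjoint Wi (N j) → Wj ⊆ N i := by
      intro i j Wi Bi Wj Bj hij hi hj hWW hWi
      by_contra hWj
      exact h.not_pair _ (.disjointMark st i j Wi Bi Wj Bj hij hi hj hWW hWj hWi)
    by_cases hdi : Disjoint Wi (N j)
    · by_cases hdj : Disjoint Wj (N i)
      · by_cases hB : Bi = Bj
        · exact absurd (.apartCompute st i j Wi Bi Wj Bj hij hi hj hdi hdj hB) (h.not_pair _)
        · exact absurd (.apartMark st i j Wi Bi Wj Bj hij hi hj hdi hdj hB) (h.not_pair _)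
      -- In the mixed case `Wi` is both inside `N j` and disjoint from it, hence empty; then `u = 0`
      -- and `Wj` is empty too, contradicting `Wi ≠ Wj`.
      · have hsub := h1 hij.symm hj hi hWW.symm hdj
        have : Wi = ∅ := by
          rw [← Finset.disjoint_self_iff_empty]
          exact hdi.mono_right hsub
        have h0 : Wj = ∅ := by
          rw [← Finset.card_eq_zero, hj.card_eq, ← hi.card_eq, this, Finset.card_empty]
        exact absurd (this.trans h0.symm) hW
    · have hsub := h1 hij hi hj hWW hdi
      refine ⟨hWW, h1 hij.symm hj hi hWW.symm fun hdj => hdi ?_, hsub⟩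
      have : Wj = ∅ := by
        rw [← Finset.disjoint_self_iff_empty]
        exact hdj.mono_right hsub
      have h0 : Wi = ∅ := by
        rw [← Finset.card_eq_zero, hi.card_eq, ← hj.card_eq, this, Finset.card_empty]
      exact absurd (h0.trans this.symm) hW
  · by_cases hB : Bi = Bj
    · exact absurd (.overlapCompute st i j Wi Bi Wj Bj hij hi hj hW hWW hB) (h.not_pair _)
    · exact absurd (.overlapMark st i j Wi Bi Wj Bj hij hi hj hW hWW hB) (h.not_pair _)

/-- All sub-tasks computed in the second loop share many workers. -/
theorem SecondLoop.exists_common (hu : 1 ≤ u) (hN : ∀ i, (N i).card = s + u)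
    (h : SecondLoop N s u T R st₀) (hd : Descends N R st₀ st) :
    ∃ X : Finset (Fin n), X.card = st₀.marked.card + (computedSince st₀ st).card * u ∧
      ∀ i ∈ computedSince st₀ st, X ⊆ N i := by
  have hsplit : ∀ i, ∃ W B, i ∈ computedSince st₀ st → Split N u R st₀ i W B := by
    intro i
    by_cases hi : i ∈ computedSince st₀ st
    · obtain ⟨W, B, hWB⟩ := h.logic.exists_split (hd.corrupted i hi)
      exact ⟨W, B, fun _ => hWB⟩
    · exact ⟨∅, ∅, fun hi' => absurd hi' hi⟩
  choose W B hWB using hsplit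
  have hrel : ∀ i ∈ computedSince st₀ st, ∀ j ∈ computedSince st₀ st, i ≠ j →
      Disjoint (W i) (W j) ∧ W i ⊆ N j ∧ W j ⊆ N i := by
    intro i hi j hj hij
    refine (h.relation hij (hWB i hi) (hWB j hj)).resolve_left fun he => ?_
    -- Equal splits would mean equal partitions, and then one computation would have settled both
    -- sub-tasks.
    refine hd.not_samePartition i hi j hj hij ((hWB i hi).samePartition ?_)
    rw [he.1, he.2]
    exact hWB j hj
  refine ⟨st₀.marked ∪ (computedSince st₀ st).biUnion W, ?_, fun i hi => ?_⟩
  · rw [Finset.card_union_of_disjoint, Finset.card_biUnion,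
      Finset.sum_congr rfl fun i hi => (hWB i hi).card_eq, Finset.sum_const, smul_eq_mul]
    · exact fun i hi j hj hij => (hrel i hi j hj hij).1
    · rw [Finset.disjoint_biUnion_right]
      exact fun i hi => Finset.disjoint_right.2 fun k hk =>
        (mem_active.1 ((hWB i hi).left_subset hk)).2
  · refine Finset.union_subset (h.marked_subset hu hN (hWB i hi))
      (Finset.biUnion_subset.2 fun j hj => ?_)
    by_cases hij : i = j
    · rw [← hij]
      exact (hWB i hi).left_subset.trans active_subset
    · exact (hrel i hi j hj hij).2.2

/-- The state `st₀` is frozen at the first computation of the second loop. All later computations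
are compared with it at once instead of being charged one by one. -/
theorem balanced_or_descends (hu : 1 ≤ u) (hA : IsAttack N s T M R)
    (hN : ∀ i, (N i).card = s + u)
    (h : Relation.ReflTransGen (Step N s u T R) State.start st) :
    Balanced N s u T R st ∨ ∃ st₀, SecondLoop N s u T R st₀ ∧
      st₀.cost * (u + 1) ≤ st₀.marked.card ∧ Descends N R st₀ st := by
  induction h with
  | refl => exact Or.inl (Or.inl (by simp [State.cost, State.start]))
  | tail hrun hstep ih =>
    have hs := Sound.of_reflTransGen hu hA hN hrun
    rcases ih with hb | ⟨st₀, h1, h2, hd⟩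
    · rcases hb.step hu hA hN hs hstep with hb | ⟨h1, h2⟩
      · exact Or.inl hb
      · exact Or.inr ⟨_, h1, h2, (Descends.refl _).step hu hA hN hs hstep⟩
    · exact Or.inr ⟨st₀, h1, h2, hd.step hu hA hN hs hstep⟩

theorem cost_mul_le (hu : 1 ≤ u) (hA : IsAttack N s T M R) (hN : ∀ i, (N i).card = s + u)
    (h : Relation.ReflTransGen (Step N s u T R) State.start st) : st.cost * u ≤ s := by
  have hle : st.cost * u ≤ st.marked.card := by
    induction h with
    | refl => simp [State.cost, State.start]
    | tail hrun hstep ih =>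
      exact hstep.cost_mul_le hu hA hN (Sound.of_reflTransGen hu hA hN hrun) ih
  exact hle.trans ((Finset.card_le_card
    (Sound.of_reflTransGen hu hA hN h).marked_subset).trans hA.1)

end Cost

/-! ### The upper bound -/

theorem le_computationBound {s u lam c : ℕ} (hu : 1 ≤ u) (hlam : 1 ≤ lam) :
    c ≤ computationBound s u lam ↔ c * (lam * u + 1) ≤ lam * (s + u + 1) ∧ c * u ≤ s := by
  have hu' : (0 : ℚ) < u := by exact_mod_cast hu
  have hl' : (0 : ℚ) < lam := by exact_mod_cast hlam
  rw [computationBound, le_min_iff, Nat.le_floor_iff (by positivity),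
    Nat.le_floor_iff (by positivity), le_div_iff₀ (by positivity), le_div_iff₀ hu']
  refine and_congr ?_ (by exact_mod_cast Iff.rfl)
  rw [← mul_le_mul_iff_right₀ hl']
  have : (lam : ℚ) * (c * (u + 1 / lam)) = c * (lam * u + 1) := by field_simp
  rw [this]
  exact_mod_cast Iff.rfl

theorem cost_le_computationBound {α : Type*} [DecidableEq α] {n s u lam : ℕ} (hu : 1 ≤ u)
    (hn : s + u < n) (hlam : 1 ≤ lam) {T : Fin (lam * n) → α} {M : Finset (Fin n)}
    {R : Fin (lam * n) → Fin n → α} {st : State (lam * n) n α}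
    (hA : IsAttack (cyclicAllocation n lam (s + u)) s T M R)
    (h : Relation.ReflTransGen (Step (cyclicAllocation n lam (s + u)) s u T R) State.start st) :
    st.cost ≤ computationBound s u lam := by
  have hN := fun i => card_cyclicAllocation (lam := lam) hn i
  refine (le_computationBound hu hlam).2 ⟨?_, cost_mul_le hu hA hN h⟩
  have hms : st.marked.card ≤ s :=
    (Finset.card_le_card (Sound.of_reflTransGen hu hA hN h).marked_subset).trans hA.1
  have hlu : lam * u + 1 ≤ lam * (u + 1) := by rw [mul_add]; omega
  have heavy : ∀ c m : ℕ, c * (u + 1) ≤ m → c * (lam * u + 1) ≤ lam * m := fun c m hcm =>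
    calc c * (lam * u + 1) ≤ c * (lam * (u + 1)) := Nat.mul_le_mul_left _ hlu
      _ = lam * (c * (u + 1)) := by ring
      _ ≤ lam * m := Nat.mul_le_mul_left _ hcm
  have hfew : st.cost * (u + 1) ≤ s + u + 1 →
      st.cost * (lam * u + 1) ≤ lam * (s + u + 1) := heavy _ _
  rcases balanced_or_descends hu hA hN h with hb | ⟨st₀, h1, h2, hd⟩
  -- The possible deficit of one is harmless: `s + 1 ≤ s + u + 1`.
  · refine hfew ?_
    rcases hb with hb | ⟨hb, -⟩ <;> omega
  · have hcost := cost_le_add_card st₀ st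
    have hm₀ := Finset.card_le_card hd.marked_subset
    rcases (computedSince st₀ st).eq_empty_or_nonempty with he | hne
    · rw [he, Finset.card_empty] at hcost
      have := Nat.mul_le_mul_right (u + 1) hcost
      rw [add_zero] at this
      exact hfew (by omega)
    · obtain ⟨X, hX, hXN⟩ := h1.exists_common hu hN hd
      have hXne : X.Nonempty := by
        rw [← Finset.card_pos, hX]
        have := Nat.mul_pos (Finset.card_pos.2 hne) hu
        omega
      have hcommon := card_add_mul_card_le hn hne hXne hXN
      rw [hX] at hcommon
      calc st.cost * (lam * u + 1)
          ≤ (st₀.cost + (computedSince st₀ st).card) * (lam * u + 1) :=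
            Nat.mul_le_mul_right _ hcost
        _ = st₀.cost * (lam * u + 1) + (computedSince st₀ st).card * (lam * u + 1) := by ring
        _ ≤ lam * st₀.marked.card + (computedSince st₀ st).card * (lam * u + 1) :=
            Nat.add_le_add_right (heavy _ _ h2) _
        _ = (computedSince st₀ st).card +
            lam * (st₀.marked.card + (computedSince st₀ st).card * u) := by ring
        _ ≤ _ := hcommon

/-! ### The lower bound -/

theorem Strategy.result_congr {p : ℕ} {α : Type*} {T T' : Fin p → α}
    (P : Strategy p α) (h : ∀ i ∈ P.queried T, T i = T' i) : P.result T = P.result T' := by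
  induction P with
  | output est => rfl
  | query i next ih =>
    have hi : T i = T' i := h i (Finset.mem_insert_self _ _)
    rw [result, result, ← hi]
    exact ih _ fun k hk => h k (Finset.mem_insert_of_mem hk)

/-- A correct protocol must compute a sub-task when the reports are also consistent with another
result of this sub-task. -/
theorem IsCorrect.mem_queried {p n s : ℕ} {α : Type*} {N : Fin p → Finset (Fin n)}
    {P : (Fin p → Fin n → Option α) → Strategy p α} (hP : IsCorrect N s P) {T T' : Fin p → α}
    {M M' : Finset (Fin n)} {R : Fin p → Fin n → α} (hA : IsAttack N s T M R)
    (hA' : IsAttack N s T' M' R) {i : Fin p} (hi : T i ≠ T' i) (h : ∀ k, k ≠ i → T k = T' k) :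
    i ∈ (P (view N R)).queried T := by
  by_contra hnot
  have he := Strategy.result_congr (T := T) (T' := T') (P (view N R)) fun k hk =>
    h k fun hki => hnot (hki ▸ hk)
  rw [hP T M R hA, hP T' M' R hA'] at he
  exact hi (congrFun he i)

/-- The workers `e, e + 1, …, e + u - 1`. -/
def block (n e u : ℕ) : Finset (Fin n) :=
  Finset.univ.filter fun j => e ≤ j.val ∧ j.val < e + u

theorem mem_block {n e u : ℕ} {j : Fin n} : j ∈ block n e u ↔ e ≤ j.val ∧ j.val < e + u := by
  simp [block]

theorem card_block {n e u : ℕ} (h : e + u ≤ n) : (block n e u).card = u := by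
  have : (block n e u).map Fin.valEmbedding = Finset.Ico e (e + u) := by
    ext k
    simp only [Finset.mem_map, mem_block, Fin.valEmbedding_apply, Finset.mem_Ico]
    exact ⟨fun ⟨j, hj, hk⟩ => hk ▸ hj, fun hk => ⟨⟨k, by omega⟩, hk, rfl⟩⟩
  rw [← Finset.card_map Fin.valEmbedding, this, Nat.card_Ico]
  omega

theorem exists_hard_attack {α : Type*} {n s u lam K : ℕ} (hu : 1 ≤ u) (hn : s + u < n)
    (hlam : 1 ≤ lam) (h1 : K * (lam * u + 1) ≤ lam * (s + u + 1)) (h2 : K * u ≤ s)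
    {a b : α} (hab : a ≠ b) :
    ∃ (T : Fin (lam * n) → α) (M : Finset (Fin n)) (R : Fin (lam * n) → Fin n → α),
      IsAttack (cyclicAllocation n lam (s + u)) s T M R ∧
      ∀ P : (Fin (lam * n) → Fin n → Option α) → Strategy (lam * n) α,
        IsCorrect (cyclicAllocation n lam (s + u)) s P →
          K ≤ ((P (view (cyclicAllocation n lam (s + u)) R)).queried T).card := by
  classical
  set N := cyclicAllocation n lam (s + u)
  -- Using all `lam` copies of a row before the next one, `K` sub-tasks occupy only the rows `0, …,
  -- e`. The workers `e, …, s + u - 1` are common to these rows, and `he` says that they have room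
  -- for `K` blocks of size `u`.
  set e := (K - 1) / lam
  have he : K = 0 ∨ e + K * u ≤ s + u := by
    rcases Nat.eq_zero_or_pos K with h | h
    · exact Or.inl h
    right
    have hle : lam * e ≤ K - 1 := Nat.mul_div_le _ _
    have : lam * (e + K * u) < lam * (s + u + 1) := by
      calc lam * (e + K * u) = lam * e + K * (lam * u) := by ring
        _ < K + K * (lam * u) := by omega
        _ = K * (lam * u + 1) := by ring
        _ ≤ _ := h1
    have := Nat.lt_of_mul_lt_mul_left this
    omega
  have hdiv : ∀ t < K, t / lam ≤ e := fun t ht => Nat.div_le_div_right (by omega)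
  have htu : ∀ t < K, t * u + u ≤ K * u := fun t ht => by
    have := Nat.mul_le_mul_right u (show t + 1 ≤ K from ht)
    rwa [add_mul, one_mul] at this
  have heK : ∀ t < K, e + K * u ≤ s + u := fun t ht => he.resolve_left (by omega)
  have hrow : ∀ t < K, t / lam < n := fun t ht => by
    have := hdiv t ht
    have := heK t ht
    omega
  have htask : ∀ t < K, t % lam * n + t / lam < lam * n := fun t ht => by
    have h3 := Nat.mod_lt t hlam
    have h4 := hrow t ht
    calc t % lam * n + t / lam < t % lam * n + n := by omega
      _ = (t % lam + 1) * n := by ring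
      _ ≤ lam * n := Nat.mul_le_mul_right _ h3
  -- This is row `t / lam` in copy `t % lam`.
  let task : Fin K → Fin (lam * n) := fun t => ⟨t % lam * n + t / lam, htask t t.isLt⟩
  have htask_mod : ∀ t : Fin K, (task t).val % n = t / lam := fun t => by
    simp only [task]
    rw [Nat.mul_add_mod', Nat.mod_eq_of_lt (hrow t t.isLt)]
  have htask_inj : Function.Injective task := fun t t' h => by
    have hd : t.val / lam = t'.val / lam := by rw [← htask_mod, ← htask_mod, h]
    have hm : t.val % lam = t'.val % lam := by
      have h' : t.val % lam * n + t.val / lam = t'.val % lam * n + t'.val / lam :=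
        congrArg Fin.val h
      rw [hd] at h'
      exact Nat.eq_of_mul_eq_mul_right (by omega) (Nat.add_right_cancel h')
    exact Fin.ext (by rw [← Nat.div_add_mod t.val lam, ← Nat.div_add_mod t'.val lam, hd, hm])
  let W : Fin K → Finset (Fin n) := fun t => block n (e + t * u) u
  have hWcard : ∀ t, (W t).card = u := fun t => card_block (by
    have := htu t t.isLt
    have := heK t t.isLt
    omega)
  have hWdisj : ∀ t t' : Fin K, ∀ j, j ∈ W t → j ∈ W t' → t = t' := by
    intro t t' j hj hj'
    simp only [W, mem_block] at hj hj'
    rcases lt_trichotomy t.val t'.val with h | h | h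
    · have := Nat.mul_le_mul_right u (show t.val + 1 ≤ t'.val from h)
      rw [add_mul, one_mul] at this
      omega
    · exact Fin.ext h
    · have := Nat.mul_le_mul_right u (show t'.val + 1 ≤ t.val from h)
      rw [add_mul, one_mul] at this
      omega
  have hWN : ∀ t t', W t ⊆ N (task t') := fun t t' j hj => by
    simp only [W, mem_block] at hj
    have h3 := hdiv t' t'.isLt
    have h4 := htu t t.isLt
    have h5 := heK t t.isLt
    have h6 : j.val < s + u := by omega
    have h7 : t'.val / lam ≤ j.val := by omega
    refine mem_cyclicAllocation.2 ⟨j.val - t' / lam, (Nat.sub_le _ _).trans_lt h6, ?_⟩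
    rw [← Nat.mod_add_mod, htask_mod, Nat.add_sub_cancel' h7,
      Nat.mod_eq_of_lt j.isLt]
  let R : Fin (lam * n) → Fin n → α := fun i j => if ∃ t, i = task t ∧ j ∈ W t then b else a
  have hRb : ∀ t, ∀ j ∈ W t, R (task t) j = b := fun t j hj => if_pos ⟨t, rfl, hj⟩
  have hRa : ∀ i j, (∀ t, i = task t → j ∉ W t) → R i j = a := fun i j h =>
    if_neg fun ⟨t, ht, hj⟩ => h t ht hj
  have hA : IsAttack N s (fun _ => a) (Finset.univ.biUnion W) R := by
    refine ⟨?_, fun i j _ hj => hRa i j fun t _ hjt =>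
      hj (Finset.mem_biUnion.2 ⟨t, Finset.mem_univ t, hjt⟩)⟩
    refine (Finset.card_biUnion_le_card_mul _ _ u fun t _ => (hWcard t).le).trans ?_
    simpa using h2
  -- The same reports arise if block `t` is truthful on its sub-task and the other `s` workers
  -- allotted it are malicious. Those include all other blocks, which explains the dissent
  -- elsewhere.
  have hA' : ∀ t, IsAttack N s (Function.update (fun _ => a) (task t) b)
      (N (task t) \ W t) R := by
    intro t
    refine ⟨?_, fun i j hj hjM => ?_⟩
    · rw [Finset.card_sdiff_of_subset (hWN t t), hWcard, card_cyclicAllocation hn]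
      omega
    · by_cases hi : i = task t
      · subst hi
        rw [Function.update_self]
        exact hRb t j (by_contra fun hjW => hjM (Finset.mem_sdiff.2 ⟨hj, hjW⟩))
      · rw [Function.update_of_ne hi]
        refine hRa i j fun t' ht' hjt' => hjM (Finset.mem_sdiff.2 ⟨hWN t' t hjt', fun hjt => ?_⟩)
        exact hi (by rw [ht', hWdisj t t' j hjt hjt'])
  refine ⟨_, _, R, hA, fun P hP => ?_⟩
  have hsub : Finset.univ.image task ⊆ (P (view N R)).queried fun _ => a := by
    intro i hi
    obtain ⟨t, -, rfl⟩ := Finset.mem_image.1 hi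
    exact hP.mem_queried hA (hA' t) (by simpa using hab)
      fun k hk => (Function.update_of_ne hk b fun _ => a).symm
  have := Finset.card_le_card hsub
  rwa [Finset.card_image_of_injective _ htask_inj, Finset.card_univ, Fintype.card_fin] at this

end ByzantineComputation

open ByzantineComputation in
theorem mainTheorem1 {α : Type*} [DecidableEq α] (n s u lam : ℕ)
    (hu : 1 ≤ u) (hus : u ≤ s) (hn : s + u < n) (hlam : 1 ≤ lam) :
    -- against any attack, every run of the Full Communication Protocol is finite, stays within the
    -- bound on local computations, and ends with the correct results of all sub-tasks
    (∀ (T : Fin (lam * n) → α) (M : Finset (Fin n)) (R : Fin (lam * n) → Fin n → α),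
      IsAttack (cyclicAllocation n lam (s + u)) s T M R →
        (¬ ∃ run : ℕ → State (lam * n) n α, run 0 = State.start ∧
          ∀ t, Step (cyclicAllocation n lam (s + u)) s u T R (run t) (run (t + 1))) ∧
        ∀ st : State (lam * n) n α,
          Relation.ReflTransGen (Step (cyclicAllocation n lam (s + u)) s u T R) State.start st →
            st.cost ≤ computationBound s u lam ∧
            ((∀ st', ¬ Step (cyclicAllocation n lam (s + u)) s u T R st st') →
              ∀ i, Outputs (cyclicAllocation n lam (s + u)) R st i (T i))) ∧
    -- optimality: some attack forces as many local computations on every correct protocol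
    (Nontrivial α →
      ∃ (T : Fin (lam * n) → α) (M : Finset (Fin n)) (R : Fin (lam * n) → Fin n → α),
        IsAttack (cyclicAllocation n lam (s + u)) s T M R ∧
        ∀ P : (Fin (lam * n) → Fin n → Option α) → Strategy (lam * n) α,
          IsCorrect (cyclicAllocation n lam (s + u)) s P →
            computationBound s u lam ≤
              ((P (view (cyclicAllocation n lam (s + u)) R)).queried T).card) := by
  refine ⟨fun T M R hA => ?_, fun hα => ?_⟩
  · have hN := fun i => card_cyclicAllocation (lam := lam) hn i
    refine ⟨no_infinite_run hu hA hN, fun st hst => ⟨cost_le_computationBound hu hn hlam hA hst,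
      fun hfinal i => (Sound.of_reflTransGen hu hA hN hst).outputs hu hA hN hfinal i⟩⟩
  · obtain ⟨a, b, hab⟩ := exists_pair_ne α
    obtain ⟨h1, h2⟩ := (le_computationBound (s := s) hu hlam).1 le_rfl
    exact exists_hard_attack hu hn hlam h1 h2 hab
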